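/- A band is a semigroup $B$ with $e^2=e$ for all $e\in B$. Write $e\,\mathcal D\,f$ if $efe=e$ and $fef=f$; $\mathcal D$ is a congruence on $B$, the quotient $Y=B/\mathcal D$ is a semilattice (the structure semilattice of $B$), and $[e]\in Y$ denotes the class of $e\in B$. The natural order on $Y$ is $\alpha\le\beta\iff\alpha\beta=\beta\alpha=\alpha$, and $B$ is called linearly ordered if $(Y,\le)$ is a chain. An automorphism $\varphi$ of $B$ induces the automorphism $[b]\mapsto[\varphi(b)]$ of $Y$. The band $B$ is homogeneous if every isomorphism between finitely generated subbands of $B$ extends to an automorphism of $B$. It is structure-homogeneous if it is homogeneous and, for every isomorphism $\theta:A_1\to A_2$ between finite subbands of $B$ and every automorphism $\hat\pi$ of $Y$ with $\hat\pi([a])=[\theta(a)]$ for all $a\in A_1$, there is an automorphism of $B$ that extends $\theta$ and induces $\hat\pi$. For $n,m\in\mathbb N^*=\{1,2,3,\dots\}\cup\{\aleph_0\}$ let $B_{n,m}=I\times J$ with $|I|=n$, $|J|=m$ and $(i,j)(k,l)=(i,l)$. Regard $\mathbb Q$ as a semilattice under $\min$, and let $\mathbb Q\times B_{n,m}$ be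 the direct product. Let $D_{n,m}$ be the set $\mathbb Q\times B_{n,m}$ with the product $$(\alpha,e)(\beta,f)=\begin{cases}(\alpha,e)&\text{if }\alpha<\beta,\\(\beta,f)&\text{if }\beta<\alpha,\\(\alpha,ef)&\text{if }\alpha=\beta.\end{cases}$$ Finally, for bands $S,T$ that are each one of the above, let $S\bowtie T=\{(s,t)\in S\times T: s\text{ and }t\text{ have the same }\mathbb Q\text{-coordinate}\}$ (the spined product over $\mathbb Q$), with componentwise multiplication. **Theorem.** Let $B$ be a countable linearly ordered band whose structure semilattice has more than one element. Then the following are equivalent: (i) $B$ is homogeneous; (ii) $B$ is structure-homogeneous; (iii) $B$ is isomorphic to one of $\mathbb Q\times B_{n,m}$, $D_{n,m}$, $(\mathbb Q\times B_{n,1})\bowtie D_{1,m}$, $D_{n,1}\bowtie(\mathbb Q\times B_{1,m})$, for some $n,m\in\mathbb N^*$. -/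

import Mathlib

/-- A band is a semigroup all of whose elements are idempotent. -/
class Band (B : Type*) extends Semigroup B where
  mul_self : ∀ e : B, e * e = e

namespace Band

/-- The natural order `e ≤ f ↔ ef = fe = e`. -/
def NatLE {B : Type*} [Mul B] (e f : B) : Prop := e * f = e ∧ f * e = e

/-- Green's relation `𝒟` on a band: `efe = e` and `fef = f`. -/
def DRel {B : Type*} [Mul B] (e f : B) : Prop := e * f * e = e ∧ f * e * f = f

section Congruence

variable {B : Type*} [Band B]

theorem factor (x c y : B) : x * c * y * c * (x * c * y) = x * c * y := by
  have h1 : x * c * y = x * (c * x * c * y) := by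
    calc x * c * y = (x * c) * (x * c) * y := by rw [mul_self]
      _ = x * (c * x * c * y) := by simp only [mul_assoc]
  calc x * c * y * c * (x * c * y)
      = (x * c * y) * (c * x * c * y) := by simp only [mul_assoc]
    _ = x * ((c * x * c * y) * (c * x * c * y)) := by rw [h1]; simp only [mul_assoc]
    _ = x * c * y := by rw [mul_self, ← h1]

theorem below_of_eq {e c : B} (x y : B) (h : e = x * c * y) : e * c * e = e := by
  rw [h]; exact factor x c y

theorem below_trans {a b c : B} (h₁ : a * b * a = a) (h₂ : b * c * b = b) :
    a * c * a = a :=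
  below_of_eq (a * b) (b * a) (by
    calc a = a * (b * c * b) * a := by rw [h₂, h₁]
      _ = a * b * c * (b * a) := by simp only [mul_assoc])

theorem below_swap (a b : B) : (a * b) * (b * a) * (a * b) = a * b :=
  below_of_eq a b (by
    calc a * b = (a * b) * (a * b) := (mul_self _).symm
      _ = a * (b * a) * b := by simp only [mul_assoc])

theorem below_left (a b : B) : (a * b) * a * (a * b) = a * b :=
  below_of_eq (a * b) b (by rw [mul_assoc, mul_self])

theorem below_mul_right {e f : B} (h : e * f * e = e) (g : B) :
    (e * g) * (f * g) * (e * g) = e * g := by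
  have h1 : (e * g) * (f * e * g) * (e * g) = e * g :=
    below_of_eq e (e * g) (by
      calc e * g = (e * g) * (e * g) := (mul_self _).symm
        _ = (e * f * e) * g * (e * g) := by rw [h]
        _ = e * (f * e * g) * (e * g) := by simp only [mul_assoc])
  have h2 : (f * e * g) * (g * f * e) * (f * e * g) = f * e * g := by
    have := below_swap (f * e) g
    simpa only [mul_assoc] using this
  have h3 : (g * f * e) * (g * f) * (g * f * e) = g * f * e := below_left (g * f) e
  exact below_trans h1 (below_trans h2 (below_trans h3 (below_swap g f)))

theorem below_mul_left {e f : B} (h : e * f * e = e) (g : B) :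
    (g * e) * (g * f) * (g * e) = g * e :=
  below_trans (below_swap g e)
    (below_trans (below_mul_right h g) (below_swap f g))

theorem below_mul {a b c d : B} (h : a * b * a = a) (h' : c * d * c = c) :
    (a * c) * (b * d) * (a * c) = a * c :=
  below_trans (below_mul_right h c) (below_mul_left h' b)

end Congruence

/-- `𝒟` is a congruence on a band. -/
def dCon (B : Type*) [Band B] : Con B where
  r := DRel
  iseqv :=
    { refl := fun e => by simp [DRel, mul_self]
      symm := fun h => ⟨h.2, h.1⟩
      trans := fun h h' => ⟨below_trans h.1 h'.1, below_trans h'.2 h.2⟩ }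
  mul' := fun h h' => ⟨below_mul h.1 h'.1, below_mul h.2 h'.2⟩

/-- The structure semilattice `Y = B/𝒟` of a band, with the quotient multiplication. -/
abbrev StructureSemilattice (B : Type*) [Band B] : Type _ := (dCon B).Quotient

/-- The class in `Y = B/𝒟` of an element of `B`. -/
def cls {B : Type*} [Band B] (e : B) : StructureSemilattice B := (e : (dCon B).Quotient)

/-- A band is linearly ordered if its structure semilattice is a chain in the natural order. -/
def IsLinearlyOrdered (B : Type*) [Band B] : Prop :=
  ∀ α β : StructureSemilattice B, NatLE α β ∨ NatLE β α

/-- Every isomorphism between finitely generated subbands extends to an automorphism. -/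
def IsHomogeneous (B : Type*) [Band B] : Prop :=
  ∀ (A₁ A₂ : Subsemigroup B),
    (∃ S : Finset B, Subsemigroup.closure (S : Set B) = A₁) →
    (∃ S : Finset B, Subsemigroup.closure (S : Set B) = A₂) →
    ∀ θ : A₁ ≃* A₂, ∃ φ : B ≃* B, ∀ a : A₁, φ (a : B) = (θ a : B)

/-- Structure-homogeneity: `B` is homogeneous and, moreover, for every isomorphism `θ` between
finite subbands and every automorphism `π` of `Y` extending the isomorphism induced by `θ` between
the structure semilattices of these subbands (regarded as subsemilattices of `Y`), some
automorphism of `B` extends `θ` and induces `π`. -/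
def IsStructureHomogeneous (B : Type*) [Band B] : Prop :=
  IsHomogeneous B ∧
  ∀ (A₁ A₂ : Subsemigroup B), (A₁ : Set B).Finite → (A₂ : Set B).Finite →
    ∀ (θ : A₁ ≃* A₂) (π : StructureSemilattice B ≃* StructureSemilattice B),
      (∀ a : A₁, π (cls (a : B)) = cls (θ a : B)) →
      ∃ φ : B ≃* B, (∀ a : A₁, φ (a : B) = (θ a : B)) ∧ ∀ b : B, cls (φ b) = π (cls b)

/-- The rectangular band `I × J` with `(i, j)(k, l) = (i, l)`. Its `ℛ`-classes are indexed by `I`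
and its `ℒ`-classes by `J`. -/
@[ext] structure Rect (I J : Type*) where
  left : I
  right : J

instance (I J : Type*) : Band (Rect I J) where
  mul e f := ⟨e.left, f.right⟩
  mul_assoc _ _ _ := rfl
  mul_self _ := rfl

/-- A set with `n` elements, for `n ∈ ℕ ∪ {ℵ₀}`. -/
def Idx (n : ℕ∞) : Type := {k : ℕ // (k : ℕ∞) < n}

/-- The rectangular band `B_{n,m}` with `n` `ℛ`-classes and `m` `ℒ`-classes. -/
abbrev RectBand (n m : ℕ∞) : Type := Rect (Idx n) (Idx m)

/-- The semilattice `(ℚ, min)`. -/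
@[ext] structure QChain where
  val : ℚ

instance : Band QChain where
  mul α β := ⟨min α.val β.val⟩
  mul_assoc α β γ := QChain.ext (min_assoc α.val β.val γ.val)
  mul_self α := QChain.ext (min_self α.val)

theorem QChain.mul_val (α β : QChain) : (α * β).val = min α.val β.val := rfl

instance (S T : Type*) [Band S] [Band T] : Band (S × T) where
  mul_self p := Prod.ext (mul_self p.1) (mul_self p.2)

/-- The band `ℚ × B_{n,m}` (direct product). -/
abbrev QRect (n m : ℕ∞) : Type := QChain × RectBand n m

/-- The band `D_{n,m}`: the disjoint union of copies of `B_{n,m}` indexed by `ℚ`, where the product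
of two elements of different levels is the one of lower level (`𝒟`-covering). -/
@[ext] structure DBand (n m : ℕ∞) where
  level : ℚ
  elt : RectBand n m

/-- Multiplication of `D_{n,m}`. -/
def DBand.mul {n m : ℕ∞} (x y : DBand n m) : DBand n m :=
  if x.level < y.level then x
  else if y.level < x.level then y
  else ⟨x.level, x.elt * y.elt⟩

instance (n m : ℕ∞) : Mul (DBand n m) := ⟨DBand.mul⟩

theorem DBand.mul_def {n m : ℕ∞} (x y : DBand n m) : x * y =
    if x.level < y.level then x
    else if y.level < x.level then y
    else ⟨x.level, x.elt * y.elt⟩ := rfl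

instance (n m : ℕ∞) : Band (DBand n m) where
  mul_assoc x y z := by
    obtain ⟨a, e⟩ := x
    obtain ⟨b, f⟩ := y
    obtain ⟨c, g⟩ := z
    rcases lt_trichotomy a b with h | h | h <;> rcases lt_trichotomy b c with h' | h' | h' <;>
      rcases lt_trichotomy a c with h'' | h'' | h'' <;>
      first
      | (exfalso; linarith)
      | (simp [DBand.mul_def, h, h', h'', not_lt_of_gt, mul_assoc])
  mul_self x := by simp [DBand.mul_def, mul_self]

/-- The projection of `ℚ × B_{n,m}` onto `ℚ`. -/
def qProj (n m : ℕ∞) : QRect n m →ₙ* QChain where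
  toFun := Prod.fst
  map_mul' _ _ := rfl

/-- The projection of `D_{n,m}` onto `ℚ`. -/
def dProj (n m : ℕ∞) : DBand n m →ₙ* QChain where
  toFun x := ⟨x.level⟩
  map_mul' x y := by
    rcases lt_trichotomy x.level y.level with h | h | h
    · exact QChain.ext (by simp [DBand.mul_def, QChain.mul_val, h, h.le])
    · exact QChain.ext (by simp [DBand.mul_def, QChain.mul_val, h])
    · exact QChain.ext (by simp [DBand.mul_def, QChain.mul_val, h, h.le, not_lt_of_gt])

/-- The spined product `S ⋈ T = {(s, t) | φ s = ψ t}` with respect to `φ : S → H`, `ψ : T → H`. -/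
def spinedProduct {S T H : Type*} [Mul S] [Mul T] [Mul H] (φ : S →ₙ* H) (ψ : T →ₙ* H) :
    Subsemigroup (S × T) where
  carrier := {p | φ p.1 = ψ p.2}
  mul_mem' {p q} hp hq := by
    change φ p.1 = ψ p.2 at hp
    change φ q.1 = ψ q.2 at hq
    change φ (p * q).1 = ψ (p * q).2
    rw [Prod.fst_mul, Prod.snd_mul, map_mul, map_mul, hp, hq]

/-- `(ℚ × B_{n,1}) ⋈ D_{1,m}`, the spined product over the common structure semilattice `ℚ`. -/
abbrev QSpinedD (n m : ℕ∞) : Type := spinedProduct (qProj n 1) (dProj 1 m)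

/-- `D_{n,1} ⋈ (ℚ × B_{1,m})`, the spined product over the common structure semilattice `ℚ`. -/
abbrev DSpinedQ (n m : ℕ∞) : Type := spinedProduct (dProj n 1) (qProj 1 m)

end Band

/-!
The classification of homogeneous linearly ordered bands rests on what an element `e` does to a
`𝒟`-class below its own by left multiplication (and dually by right multiplication).

In a homogeneous band `B` all pairs `x < e` of the natural order are conjugate under automorphisms,
so the structure semilattice is a countable dense chain without endpoints, that is, `ℚ`
(`exists_levelMap`). On an `ℒ`-class of a lower level, left multiplication by `e` is either the
identity or constant (`identity_or_constant`): otherwise, permuting three members of the `ℒ`-class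
cyclically gives a conjugate `k` of `e` such that `ke` is not idempotent (`no_mixed_action`). By
conjugacy of pairs, the same alternative holds throughout `B`.

If the action is the identity, the `ℛ`-classes of the levels can be indexed by one set, level by
level. If it is constant, each `ℛ`-class of a level determines one of every lower level; these maps
are compatible, injective (`ConstantAction.injective`) and onto (`ConstantAction.exists_above`), and
so index the `ℛ`-classes of all levels coherently. In both cases this is a left coordinate on `B`,
and the opposite band supplies a right coordinate. Together with the level they present `B` as
`ℚ × I × J` with one of four multiplications (`IsCoordinates`), which are those of the four families.

Conversely, let `B` have such coordinates. An isomorphism between finite subbands induces finite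
partial injections of `ℚ`, of `I` and of `J`, the latter two depending on the level in case of an
identity action and independent of it in case of a constant one. The first extends to an
automorphism of `ℚ` by back-and-forth, unless such an extension is prescribed; the others extend to
permutations. These extensions assemble to an automorphism of `B` (`IsCoordinates.twist`,
`IsCoordinates.exists_extension`).
-/

namespace Band

/-! ### Level maps -/

/-- A level map identifies the structure semilattice of `B` with the chain `ℚ`: it is onto, and
`a` lies below `b` exactly if the class of `a` is below that of `b`, that is, `aba = a`. -/
structure IsLevelMap {B : Type*} [Band B] (lev : B → ℚ) : Prop where
  surj : Function.Surjective lev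
  le_iff : ∀ a b, lev a ≤ lev b ↔ a * b * a = a

namespace IsLevelMap

variable {B : Type*} [Band B] {lev : B → ℚ} (hl : IsLevelMap lev)
include hl

theorem sandwich {a b : B} (h : lev a ≤ lev b) : a * b * a = a := (hl.le_iff a b).1 h

theorem map_mul (a b : B) : lev (a * b) = min (lev a) (lev b) := by
  have h1 : lev (a * b) ≤ lev a := (hl.le_iff _ _).2 (below_left a b)
  have h2 : lev (a * b) ≤ lev b :=
    (hl.le_iff _ _).2 (by rw [mul_assoc a b b, mul_self, mul_self])
  refine le_antisymm (le_min h1 h2) ?_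
  rcases le_total (lev a) (lev b) with h | h
  · rw [min_eq_left h, hl.le_iff, ← mul_assoc, mul_self, hl.sandwich h]
  · rw [min_eq_right h, hl.le_iff, mul_assoc, mul_assoc, mul_self, ← mul_assoc, hl.sandwich h]

theorem map_mul_of_le {a b : B} (h : lev a ≤ lev b) : lev (a * b) = lev a := by
  rw [hl.map_mul, min_eq_left h]

theorem map_mul_of_ge {a b : B} (h : lev b ≤ lev a) : lev (a * b) = lev b := by
  rw [hl.map_mul, min_eq_right h]

/-- Levels are rectangular bands; the middle factor may even lie at a higher level. -/
theorem rect {a b c : B} (hac : lev a = lev c) (hab : lev a ≤ lev b) :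
    a * b * c = a * c := by
  have h1 : c * a * c = c := hl.sandwich hac.ge
  have h2 : a * (b * c) * a = a := hl.sandwich (by rw [hl.map_mul]; exact le_min hab hac.le)
  calc a * b * c = a * b * (c * a * c) := by rw [h1]
    _ = a * (b * c) * a * c := by simp only [mul_assoc]
    _ = a * c := by rw [h2]

theorem le_of_mul_eq {a b : B} (h : b * a = a) : lev a ≤ lev b := by
  rw [← h, hl.map_mul]; exact min_le_left _ _

theorem mul_eq_comm {a b : B} (hab : lev a = lev b) (h : b * a = a) : a * b = b := by
  rw [← h, hl.sandwich hab.ge]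

theorem map_le_iff (φ : B ≃* B) (a b : B) : lev (φ a) ≤ lev (φ b) ↔ lev a ≤ lev b := by
  rw [hl.le_iff, hl.le_iff, ← _root_.map_mul, ← _root_.map_mul, φ.injective.eq_iff]

theorem map_lt_iff (φ : B ≃* B) (a b : B) : lev (φ a) < lev (φ b) ↔ lev a < lev b := by
  rw [← not_le, ← not_le, hl.map_le_iff]

theorem map_eq_iff (φ : B ≃* B) (a b : B) : lev (φ a) = lev (φ b) ↔ lev a = lev b := by
  simp only [le_antisymm_iff, hl.map_le_iff]

end IsLevelMap

/-- `a` and `b` are related by Green's relation `ℒ`: they form a left zero subband. -/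
def LRel {B : Type*} [Mul B] (a b : B) : Prop := a * b = a ∧ b * a = b

theorem LRel.symm {B : Type*} [Mul B] {a b : B} (h : LRel a b) : LRel b a := ⟨h.2, h.1⟩

theorem LRel.trans {B : Type*} [Semigroup B] {a b c : B} (h : LRel a b) (h' : LRel b c) :
    LRel a c := by
  constructor
  · rw [← h.1, mul_assoc, h'.1]
  · rw [← h'.2, mul_assoc, h.2]

theorem LRel.map {B : Type*} [Mul B] {a b : B} (h : LRel a b) (φ : B ≃* B) :
    LRel (φ a) (φ b) := ⟨by rw [← map_mul, h.1], by rw [← map_mul, h.2]⟩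

namespace IsLevelMap

variable {B : Type*} [Band B] {lev : B → ℚ} (hl : IsLevelMap lev)
include hl

theorem eq_of_lRel {a b : B} (h : LRel a b) : lev a = lev b :=
  le_antisymm (by rw [← h.1, hl.map_mul]; exact min_le_right _ _)
    (by rw [← h.2, hl.map_mul]; exact min_le_right _ _)

theorem lRel_mul {a b : B} (h : lev b ≤ lev a) : LRel (a * b) b :=
  ⟨by rw [mul_assoc, mul_self], by rw [← mul_assoc, hl.sandwich h]⟩

end IsLevelMap

/-! ### Extension of isomorphisms between small subbands -/

/-- The form in which homogeneity is used: an isomorphism between finite subbands, given as a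
bijection between the members of two finite injective families, extends to an automorphism. -/
def ExtendsFinite (B : Type*) [Mul B] : Prop :=
  ∀ (n : ℕ) (f g : Fin n → B), Function.Injective f → Function.Injective g →
    (∀ i j, ∃ k, f i * f j = f k ∧ g i * g j = g k) → ∃ φ : B ≃* B, ∀ i, φ (f i) = g i

theorem IsHomogeneous.extendsFinite {B : Type*} [Band B] (h : IsHomogeneous B) :
    ExtendsFinite B := by
  classical
  intro n f g hf hg hm
  let A : ∀ u : Fin n → B, (∀ i j, ∃ k, u i * u j = u k) → Subsemigroup B := fun u hu =>
    { carrier := Set.range u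
      mul_mem' := by
        rintro _ _ ⟨i, rfl⟩ ⟨j, rfl⟩
        obtain ⟨k, hk⟩ := hu i j
        exact ⟨k, hk.symm⟩ }
  have fg : ∀ u hu, ∃ S : Finset B, Subsemigroup.closure (S : Set B) = A u hu := fun u hu =>
    ⟨Finset.univ.image u, by
      rw [Finset.coe_image, Finset.coe_univ, Set.image_univ]
      exact Subsemigroup.closure_eq (A u hu)⟩
  have hf' : ∀ i j, ∃ k, f i * f j = f k := fun i j => (hm i j).imp fun _ => And.left
  have hg' : ∀ i j, ∃ k, g i * g j = g k := fun i j => (hm i j).imp fun _ => And.right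
  let ef : Fin n ≃ A f hf' := Equiv.ofInjective f hf
  let eg : Fin n ≃ A g hg' := Equiv.ofInjective g hg
  let θ : A f hf' ≃* A g hg' :=
    { ef.symm.trans eg with
      map_mul' := by
        intro x y
        obtain ⟨i, rfl⟩ := ef.surjective x
        obtain ⟨j, rfl⟩ := ef.surjective y
        obtain ⟨k, hk, hk'⟩ := hm i j
        have e1 : ef i * ef j = ef k := Subtype.ext hk
        have e2 : eg i * eg j = eg k := Subtype.ext hk'
        simp [e1, e2] }
  obtain ⟨φ, hφ⟩ := h _ _ (fg f hf') (fg g hg') θ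
  refine ⟨φ, fun i => ?_⟩
  have := hφ (ef i)
  have hθ : θ (ef i) = eg i := by simp [θ]
  rw [hθ] at this
  exact this

instance (B : Type*) [Band B] : Band Bᵐᵒᵖ where
  mul_self e := MulOpposite.unop_injective (mul_self e.unop)

open MulOpposite in
theorem ExtendsFinite.op {B : Type*} [Band B] (h : ExtendsFinite B) : ExtendsFinite Bᵐᵒᵖ := by
  intro n f g hf hg hm
  obtain ⟨φ, hφ⟩ := h n (unop ∘ f) (unop ∘ g) (unop_injective.comp hf) (unop_injective.comp hg)
    (fun i j => by
      obtain ⟨k, h1, h2⟩ := hm j i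
      exact ⟨k, congrArg unop h1, congrArg unop h2⟩)
  exact ⟨MulEquiv.op φ, fun i => unop_injective (hφ i)⟩

theorem IsLevelMap.op {B : Type*} [Band B] {lev : B → ℚ} (hl : IsLevelMap lev) :
    IsLevelMap (lev ∘ MulOpposite.unop) where
  surj := hl.surj.comp MulOpposite.unop_surjective
  le_iff a b := by
    rw [Function.comp_apply, Function.comp_apply, hl.le_iff, ← MulOpposite.unop_injective.eq_iff]
    simp [mul_assoc]

namespace ExtendsFinite

variable {B : Type*} [Band B] (h : ExtendsFinite B)
include h

theorem exists_map_eq (a b : B) : ∃ φ : B ≃* B, φ a = b := by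
  obtain ⟨φ, hφ⟩ := h 1 (fun _ => a) (fun _ => b) (Function.injective_of_subsingleton _)
    (Function.injective_of_subsingleton _) (fun _ _ => ⟨0, mul_self _, mul_self _⟩)
  exact ⟨φ, hφ 0⟩

theorem exists_map_natLE {x e x' e' : B} (hx : NatLE x e) (hne : x ≠ e) (hx' : NatLE x' e')
    (hne' : x' ≠ e') : ∃ φ : B ≃* B, φ x = x' ∧ φ e = e' := by
  obtain ⟨φ, hφ⟩ := h 2 ![x, e] ![x', e']
    (by intro i j; fin_cases i <;> fin_cases j <;> simp [hne, hne.symm])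
    (by intro i j; fin_cases i <;> fin_cases j <;> simp [hne', hne'.symm])
    (fun i j => ⟨min i j, by
      fin_cases i <;> fin_cases j <;> simp [hx.1, hx.2, hx'.1, hx'.2, mul_self]⟩)
  exact ⟨φ, hφ 0, hφ 1⟩

theorem exists_swap {x y : B} (hxy : LRel x y) (hne : x ≠ y) :
    ∃ φ : B ≃* B, φ x = y ∧ φ y = x := by
  obtain ⟨φ, hφ⟩ := h 2 ![x, y] ![y, x]
    (by intro i j; fin_cases i <;> fin_cases j <;> simp [hne, hne.symm])
    (by intro i j; fin_cases i <;> fin_cases j <;> simp [hne, hne.symm])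
    (fun i j => ⟨i, by
      fin_cases i <;> fin_cases j <;> simp [hxy.1, hxy.2, mul_self]⟩)
  exact ⟨φ, hφ 0, hφ 1⟩

theorem exists_cycle {x y z : B} (hxy : LRel x y) (hyz : LRel y z) (h1 : x ≠ y) (h2 : y ≠ z)
    (h3 : x ≠ z) : ∃ φ : B ≃* B, φ x = y ∧ φ y = z ∧ φ z = x := by
  have hxz := hxy.trans hyz
  obtain ⟨φ, hφ⟩ := h 3 ![x, y, z] ![y, z, x]
    (by intro i j; fin_cases i <;> fin_cases j <;> simp [h1, h1.symm, h2, h2.symm, h3, h3.symm])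
    (by intro i j; fin_cases i <;> fin_cases j <;> simp [h1, h1.symm, h2, h2.symm, h3, h3.symm])
    (fun i j => ⟨i, by
      fin_cases i <;> fin_cases j <;>
        simp [hxy.1, hxy.2, hyz.1, hyz.2, hxz.1, hxz.2, mul_self]⟩)
  exact ⟨φ, hφ 0, hφ 1, hφ 2⟩

end ExtendsFinite

/-! ### Left multiplication on a lower level -/

section Left

variable {B : Type*} [Band B] {lev : B → ℚ}

/-- The heart of the dichotomy below: left multiplication by `e` cannot collapse two elements of an
`ℒ`-class while fixing a third. If `ez = x ≠ z` and `ey = y ≠ x` with `x`, `y`, `z` in one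
`ℒ`-class, let `k` be the image of `e` under an automorphism that permutes `x`, `y`, `z` cyclically.
Then `(ke)y = z` and `(ke)z = x`, so `ke` would not be idempotent. -/
theorem no_mixed_action (h : ExtendsFinite B) {e x y z : B} (hyz : LRel y z)
    (hxz : LRel x z) (hez : e * z = x) (hey : e * y = y) (h1 : x ≠ z) (h2 : x ≠ y)
    (h3 : y ≠ z) : False := by
  obtain ⟨θ, hx, hz, hy⟩ := h.exists_cycle hxz hyz.symm h1 h3.symm h2
  have k1 : θ e * y = z := by rw [← hz, ← map_mul, hez, hx]
  have k2 : θ e * x = x := by rw [← hy, ← map_mul, hey]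
  have hid := congrArg (· * y) (mul_self (θ e * e))
  simp only [mul_assoc, hey, k1, hez, k2] at hid
  exact h1 hid

theorem identity_or_constant (h : ExtendsFinite B) (hl : IsLevelMap lev) (e : B) (q : ℚ)
    (hq : q < lev e) : (∀ x, lev x = q → e * x = x) ∨
      (∀ x y, lev x = q → LRel x y → e * x = e * y) := by
  by_contra! hcon
  obtain ⟨⟨z, hz, hez⟩, x', y', hx', hxy', hne⟩ := hcon
  have hze : lev z ≤ lev e := hz ▸ hq.le
  have hy' : lev y' = q := (hl.eq_of_lRel hxy').symm.trans hx'
  -- one of `x'z`, `y'z` has an image different from that of `z`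
  obtain ⟨w, hw, hwz, hew⟩ : ∃ w, lev w = q ∧ LRel w z ∧ e * w ≠ e * z := by
    by_contra! hcon
    have e1 := hcon (x' * z) (by rw [hl.map_mul, hx', hz, min_self])
      (hl.lRel_mul (by rw [hx', hz]))
    have e2 := hcon (y' * z) (by rw [hl.map_mul, hy', hz, min_self])
      (hl.lRel_mul (by rw [hy', hz]))
    apply hne
    have e3 : x' * z * x' = x' := hl.sandwich (by rw [hx', hz])
    have e4 : y' * z * x' = y' := by
      rw [hl.rect (by rw [hx', hy']) (by rw [hy', hz]), hxy'.2]
    calc e * x' = e * (x' * z) * x' := by rw [mul_assoc e, e3]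
      _ = e * (y' * z) * x' := by rw [e1, e2]
      _ = e * y' := by rw [mul_assoc e, e4]
  have hew' : LRel (e * w) z := (hl.lRel_mul (by rw [hw]; exact hq.le)).trans hwz
  refine no_mixed_action h hew' (hl.lRel_mul hze) rfl (by rw [← mul_assoc, mul_self]) hez
    hew.symm ?_
  intro hcon
  apply hez
  rw [← hcon, ← mul_assoc, mul_self]

/-- The action is of one type throughout `B`: if `e` fixes one lower level pointwise, then every
element fixes all lower levels pointwise, since all pairs `x < e` are conjugate. -/
theorem identity_transfer (h : ExtendsFinite B) (hl : IsLevelMap lev) {e : B} {q : ℚ}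
    (hq : q < lev e) (hid : ∀ x, lev x = q → e * x = x) {e' x' : B} (hlt : lev x' < lev e') :
    e' * x' = x' := by
  -- `ewe` lies below `e` on the level of `w`
  have key : ∀ {e w : B}, lev w < lev e →
      NatLE (e * w * e) e ∧ e * w * e ≠ e ∧ lev (e * w * e) = lev w := by
    intro e w hw
    have hlev : lev (e * w * e) = lev w := by
      rw [mul_assoc, hl.map_mul, hl.map_mul, min_eq_left hw.le, min_eq_right hw.le]
    refine ⟨⟨by rw [mul_assoc, mul_self], by rw [← mul_assoc, ← mul_assoc, mul_self]⟩, ?_, hlev⟩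
    intro hcon
    rw [hcon] at hlev
    exact hw.ne' hlev
  obtain ⟨w, rfl⟩ := hl.surj q
  obtain ⟨a1, a2, a3⟩ := key hq
  obtain ⟨b1, b2, b3⟩ := key hlt
  obtain ⟨φ, h1, h2⟩ := h.exists_map_natLE b1 b2 a1 a2
  apply φ.injective
  rw [map_mul, h2]
  refine hid _ ?_
  rw [← a3, ← h1, hl.map_eq_iff, b3]

/-- `e * ·` is constant on the `ℒ`-classes of all levels below `e`. -/
def ConstantAction (lev : B → ℚ) : Prop :=
  ∀ e x y : B, lev x < lev e → LRel x y → e * x = e * y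

theorem identity_or_constantAction (h : ExtendsFinite B) (hl : IsLevelMap lev) :
    (∀ a b, lev b < lev a → a * b = b) ∨ ConstantAction lev := by
  by_cases hid : ∃ e q, q < lev e ∧ ∀ x, lev x = q → e * x = x
  · obtain ⟨e, q, hq, hid⟩ := hid
    exact .inl fun a b hab => identity_transfer h hl hq hid hab
  · refine .inr fun e x y hlt hxy => ?_
    rcases identity_or_constant h hl e _ hlt with h1 | h1
    · exact (hid ⟨e, _, hlt, h1⟩).elim
    · exact h1 x y rfl hxy

/-- A coordinate for the `ℛ`-classes of `B`. On each level it separates exactly the `ℛ`-classes and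
takes all values. A factor from a higher level passes its coordinate on to the product if `s` holds,
and does not affect the coordinate otherwise. -/
structure IsLeftCoord {I : Type*} (lev : B → ℚ) (s : Bool) (l : B → I) : Prop where
  eq_iff : ∀ a b, lev a = lev b → (l a = l b ↔ b * a = a)
  surj : ∀ q i, ∃ b, lev b = q ∧ l b = i
  map_mul : ∀ a b, lev b < lev a → l (a * b) = if s then l a else l b

/-- If factors from higher levels act identically, then the levels are coordinatized independently
of one another, each by an automorphism that carries it to level `0`. -/
theorem exists_leftCoord_of_identity [Countable B] (h : ExtendsFinite B) (hl : IsLevelMap lev)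
    (hid : ∀ a b, lev b < lev a → a * b = b) :
    ∃ (I : Set B) (l : B → I), IsLeftCoord lev false l := by
  choose e he using hl.surj
  choose φ hφ using fun q => h.exists_map_eq (e q) (e 0)
  have hlev : ∀ q b, lev b = q ↔ lev (φ q b) = 0 := by
    intro q b
    rw [← he 0, ← hφ q, hl.map_eq_iff, he]
  refine ⟨{x | LRel x (e 0)}, fun b => ⟨φ (lev b) b * e 0, hl.lRel_mul ?_⟩, ?_, ?_, ?_⟩
  · rw [he, (hlev _ b).1 rfl]
  · intro a b hab
    rw [Subtype.mk.injEq, hab, ← hφ (lev b), ← map_mul, ← map_mul, (φ _).injective.eq_iff]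
    have hb := he (lev b)
    constructor
    · intro H
      have h1 : a * e (lev b) * a = a := hl.sandwich (by rw [hb, hab])
      calc b * a = b * (a * e (lev b) * a) := by rw [h1]
        _ = b * b * e (lev b) * a := by rw [H]; simp only [mul_assoc]
        _ = a := by rw [mul_self, ← H, h1]
    · intro H
      rw [← H, hl.rect hb.symm hab.ge]
  · rintro q ⟨x, hx⟩
    have hb : lev ((φ q).symm x) = q := by
      rw [hlev, MulEquiv.apply_symm_apply, hl.eq_of_lRel hx, he]
    exact ⟨(φ q).symm x, hb, Subtype.ext (by simp only [hb, MulEquiv.apply_symm_apply, hx.1])⟩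
  · intro a b hab
    simp [hid a b hab]

/-! ### Constant actions -/

/-- The levels on which two elements act alike form an initial segment. -/
theorem ConstantAction.eq_of_le (hc : ConstantAction lev) (hl : IsLevelMap lev) {e f u v : B}
    (huv : lev u ≤ lev v) (he : lev v < lev e) (hf : lev v < lev f) (H : e * v = f * v) :
    e * u = f * u := by
  have h1 := hl.lRel_mul huv
  have hlev := hl.eq_of_lRel h1
  rw [← hc e _ _ (by rw [hlev]; exact huv.trans_lt he) h1,
    ← hc f _ _ (by rw [hlev]; exact huv.trans_lt hf) h1, ← mul_assoc, ← mul_assoc, H]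

/-- If two distinct `ℒ`-related elements act alike on some lower level, then so does their whole
`ℒ`-class: permuting three members of the class cyclically moves the levels on which two of them
agree, but these levels form an initial segment for each pair. -/
theorem ConstantAction.all_agree (hc : ConstantAction lev) (h : ExtendsFinite B)
    (hl : IsLevelMap lev) {e f x : B} (hef : LRel e f) (hne : e ≠ f) (hx : lev x < lev e)
    (hex : e * x = x) (hfx : f * x = x) {g : B} (hg : LRel g e) : g * x = x := by
  by_contra hgx
  have hge : g ≠ e := by rintro rfl; exact hgx hex
  have hgf : g ≠ f := by rintro rfl; exact hgx hfx
  obtain ⟨θ, h1, h2, h3⟩ := h.exists_cycle hef (hg.trans hef).symm hne hgf.symm hge.symm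
  have e1 : f * θ x = θ x := by rw [← h1, ← map_mul, hex]
  have e2 : g * θ x = θ x := by rw [← h2, ← map_mul, hfx]
  have e3 : e * θ x ≠ θ x := by
    rw [← h3, ← map_mul, Ne, θ.injective.eq_iff]; exact hgx
  have hf : lev f = lev e := (hl.eq_of_lRel hef).symm
  have hg' : lev g = lev e := hl.eq_of_lRel hg
  rcases le_total (lev x) (lev (θ x)) with hle | hle
  · have hlt : lev (θ x) < lev f := by rw [← h1, hl.map_lt_iff]; exact hx
    apply hgx
    rw [← hc.eq_of_le hl hle hlt (by rw [hg', ← hf]; exact hlt) (e1.trans e2.symm), hfx]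
  · apply e3
    rw [hc.eq_of_le hl hle hx (by rw [hf]; exact hx) (hex.trans hfx.symm), e1]

/-- Distinct `ℒ`-related elements act differently on every lower level. Otherwise every `ℒ`-class
would act in a single way on every lower level, and only one `ℛ`-class of each level would have
elements above it. -/
theorem ConstantAction.injective (hc : ConstantAction lev) (h : ExtendsFinite B)
    (hl : IsLevelMap lev) (hnid : ¬ ∀ a b, lev b < lev a → a * b = b) {e f x : B}
    (hef : LRel e f) (hx : lev x < lev e) (hex : e * x = x) (hfx : f * x = x) : e = f := by
  by_contra hne
  push Not at hnid
  obtain ⟨d, z, hzd, hdz⟩ := hnid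
  have hlx : lev (x * e) = lev x := hl.map_mul_of_le hx.le
  -- by conjugacy, every `ℒ`-class acts in a single way on every lower level
  have all : ∀ {e' x' g : B}, NatLE x' e' → lev x' < lev e' → LRel g e' → g * x' = x' := by
    intro e' x' g hx' hlt hg
    obtain ⟨φ, h1, h2⟩ := h.exists_map_natLE hx' (by rintro rfl; exact hlt.false)
      (x' := x * e) (e' := e) ⟨by rw [mul_assoc, mul_self], by rw [← mul_assoc, hex]⟩
      (fun hcon => by rw [hcon] at hlx; exact hx.ne' hlx)
    apply φ.injective
    rw [map_mul, h1]
    exact hc.all_agree h hl hef hne (hlx ▸ hx) (by rw [← mul_assoc, hex])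
      (by rw [← mul_assoc, hfx]) (h2 ▸ hg.map φ)
  have hw : lev (d * z * d) = lev z := by
    rw [mul_assoc, hl.map_mul, hl.map_mul, min_eq_left hzd.le, min_eq_right hzd.le]
  have hwd : NatLE (d * z * d) d :=
    ⟨by rw [mul_assoc, mul_self], by rw [← mul_assoc, ← mul_assoc, mul_self]⟩
  -- `z`, which `d` moves, also has an element `k` above it; compare `k` with `d`
  obtain ⟨φ, hφ⟩ := h.exists_map_eq (d * z * d) z
  set k := φ d with hk
  have hzk : NatLE z k := ⟨by rw [← hφ, hk, ← map_mul, hwd.1], by rw [← hφ, hk, ← map_mul, hwd.2]⟩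
  have hlt : lev z < lev k := by
    have : lev (φ (d * z * d)) < lev k := by rw [hk, hl.map_lt_iff, hw]; exact hzd
    rwa [hφ] at this
  rcases le_total (lev d) (lev k) with hle | hle
  · have h1 := all hwd (hw ▸ hzd) (hl.lRel_mul hle)
    have h2 : k * (d * z) = z := by
      have h3 := hl.lRel_mul hzd.le
      rw [hc k _ _ (by rw [hl.eq_of_lRel h3]; exact hlt) h3, hzk.2]
    have h3 : z * d = d * z * d := by
      rw [← h1]
      calc z * d = k * (d * z) * d := by rw [h2]
        _ = k * (d * d) * z * d := by rw [mul_self]; simp only [mul_assoc]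
        _ = _ := by simp only [mul_assoc]
    apply hdz
    have h4 := hl.sandwich hzd.le
    calc d * z = d * z * d * z := by rw [mul_assoc d z d, mul_assoc d, h4]
      _ = z := by rw [← h3, h4]
  · apply hdz
    have h1 := all hzk hlt (hl.lRel_mul hle)
    rwa [mul_assoc, hzk.2] at h1

/-- Every element has elements above it on each higher level. If `d` lies above `db` and `θ` swaps
`b` and `db`, then `θ d` and `θ⁻¹ d` lie above `b`, and one of them is at least as high as `d`. -/
theorem ConstantAction.exists_above (hc : ConstantAction lev) (h : ExtendsFinite B)
    (hl : IsLevelMap lev) (b : B) {q : ℚ} (hq : lev b < q) : ∃ c, lev c = q ∧ c * b = b := by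
  obtain ⟨d, rfl⟩ := hl.surj q
  have hdb := hl.lRel_mul hq.le
  by_cases hne : d * b = b
  · exact ⟨d, rfl, hne⟩
  have hlev := hl.eq_of_lRel hdb
  have key : ∀ d', lev d ≤ lev d' → d' * b = b → ∃ c, lev c = lev d ∧ c * b = b := by
    intro d' hle hd'
    refine ⟨d' * d, hl.map_mul_of_ge hle, ?_⟩
    rw [mul_assoc, hc d' _ _ (by rw [hlev]; exact hq.trans_le hle) hdb, hd']
  obtain ⟨θ, h1, h2⟩ := h.exists_swap hdb hne
  have hdd : d * (d * b) = d * b := by rw [← mul_assoc, mul_self]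
  rcases le_total (lev d) (lev (θ d)) with hle | hle
  · refine key (θ d) hle ?_
    have := congrArg θ hdd
    rwa [map_mul, h1] at this
  · refine key (θ.symm d) ?_ ?_
    · rw [← hl.map_le_iff θ, MulEquiv.apply_symm_apply]; exact hle
    · apply θ.injective
      rw [map_mul, MulEquiv.apply_symm_apply, h2, hdd]

/-- Under a constant action, comparability in the `ℛ`-preorder is an equivalence relation, and each
of its classes meets each level in one `ℛ`-class. -/
theorem exists_leftCoord_of_constant (h : ExtendsFinite B) (hl : IsLevelMap lev)
    (hc : ConstantAction lev) (hnid : ¬ ∀ a b, lev b < lev a → a * b = b) :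
    ∃ (I : Setoid B), IsLeftCoord lev true (Quotient.mk I) := by
  -- transitivity for `a`, `c` below a common `b`, respectively above a common `b`
  have down : ∀ a b c : B, lev a ≤ lev c → b * a = a → b * c = c → c * a = a := by
    intro a b c hac ha hb
    have hab := hl.le_of_mul_eq ha
    rcases hab.eq_or_lt with hlt | hlt
    · have hcb := hl.le_of_mul_eq hb
      calc c * a = b * c * a := by rw [hb]
        _ = a := by rw [hl.rect hlt.symm (hlt ▸ hac), ha]
    · have hca := hl.lRel_mul hac
      calc c * a = b * (c * a) := by rw [← mul_assoc, hb]
        _ = b * a := hc b _ _ (by rw [hl.eq_of_lRel hca]; exact hlt) hca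
        _ = a := ha
  have up : ∀ a b c : B, lev a ≤ lev c → a * b = b → c * b = b → c * a = a := by
    intro a b c hac ha hb
    have hba := hl.le_of_mul_eq ha
    rcases hba.eq_or_lt with hlt | hlt
    · have h1 := hl.sandwich hlt.ge
      rw [ha] at h1
      rw [← h1, ← mul_assoc, hb]
    · have hca := hl.lRel_mul hac
      exact hc.injective h hl hnid hca (by rw [hl.eq_of_lRel hca]; exact hlt)
        (by rw [mul_assoc, ha, hb]) ha
  let I : Setoid B :=
    { r := fun a b => b * a = a ∨ a * b = b
      iseqv :=
        { refl := fun a => .inl (mul_self a)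
          symm := fun h => h.symm
          trans := by
            intro a b c hab hbc
            rcases hab with hab | hab <;> rcases hbc with hbc | hbc
            · exact .inl (by rw [← hab, ← mul_assoc, hbc])
            · exact (le_total (lev a) (lev c)).imp (fun hle => down a b c hle hab hbc)
                (fun hle => down c b a hle hbc hab)
            · exact (le_total (lev a) (lev c)).imp (fun hle => up a b c hle hab hbc)
                (fun hle => up c b a hle hbc hab)
            · exact .inr (by rw [← hbc, ← mul_assoc, hab]) } }
  refine ⟨I, ?_, ?_, ?_⟩
  · intro a b hab
    rw [Quotient.eq]
    exact ⟨fun H => H.elim id (hl.mul_eq_comm hab.symm), .inl⟩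
  · intro q i
    induction i using Quotient.inductionOn with | h b => ?_
    rcases lt_or_ge (lev b) q with hq | hq
    · obtain ⟨c, hc1, hc2⟩ := hc.exists_above h hl b hq
      exact ⟨c, hc1, Quotient.sound (.inr hc2)⟩
    · obtain ⟨w, rfl⟩ := hl.surj q
      exact ⟨b * w, hl.map_mul_of_ge hq, Quotient.sound (.inl (by rw [← mul_assoc, mul_self]))⟩
  · intro a b _
    exact Quotient.sound (.inl (by rw [← mul_assoc, mul_self]))

end Left

theorem exists_equiv_idx (I : Type*) [Countable I] [Nonempty I] :
    ∃ n : ℕ∞, n ≠ 0 ∧ Nonempty (I ≃ Idx n) := by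
  rcases finite_or_infinite I with hfin | hinf
  · obtain ⟨k, ⟨e⟩⟩ := Finite.exists_equiv_fin I
    refine ⟨k, ?_, ⟨e.trans (Fin.equivSubtype.trans (Equiv.subtypeEquivRight (by simp)))⟩⟩
    rintro hk
    obtain rfl : k = 0 := by exact_mod_cast hk
    exact (e (Classical.arbitrary I)).elim0
  · obtain ⟨e⟩ := nonempty_equiv_of_countable (α := I) (β := ℕ)
    exact ⟨⊤, by simp, ⟨e.trans (Equiv.subtypeUnivEquiv (by simp)).symm⟩⟩

theorem exists_leftCoord {B : Type*} [Band B] [Countable B] {lev : B → ℚ} (h : ExtendsFinite B)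
    (hl : IsLevelMap lev) :
    ∃ n : ℕ∞, n ≠ 0 ∧ ∃ (s : Bool) (l : B → Idx n), IsLeftCoord lev s l := by
  obtain ⟨b, -⟩ := hl.surj 0
  have transport : ∀ {J : Type _} [Countable J] {s : Bool} {l : B → J}, IsLeftCoord lev s l →
      ∃ n : ℕ∞, n ≠ 0 ∧ ∃ (s : Bool) (l : B → Idx n), IsLeftCoord lev s l := by
    intro J _ s l hl'
    have : Nonempty J := ⟨l b⟩
    obtain ⟨n, hn, ⟨e⟩⟩ := exists_equiv_idx J
    refine ⟨n, hn, s, e ∘ l, ?_, ?_, ?_⟩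
    · intro a b hab
      rw [← hl'.eq_iff a b hab]
      exact e.injective.eq_iff
    · intro q i
      obtain ⟨b, h1, h2⟩ := hl'.surj q (e.symm i)
      exact ⟨b, h1, by simp [h2]⟩
    · intro a b hab
      have := hl'.map_mul a b hab
      cases s <;> simp_all
  by_cases hid : ∀ a b, lev b < lev a → a * b = b
  · obtain ⟨I, l, h1⟩ := exists_leftCoord_of_identity h hl hid
    exact transport h1
  · obtain ⟨I, h1⟩ := exists_leftCoord_of_constant h hl
      ((identity_or_constantAction h hl).resolve_left hid) hid
    exact transport h1

/-! ### Coordinates -/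

/-- `B` is coordinatized by `b ↦ (lev b, l b, r b)` as `ℚ × I × J`. A factor from a higher level
imposes its left coordinate on the product exactly if `s` holds, and its right coordinate exactly if
`t` holds. The four choices of `(s, t)` describe the four families of the classification. -/
structure IsCoordinates {B I J : Type*} [Mul B] (s t : Bool) (lev : B → ℚ) (l : B → I)
    (r : B → J) : Prop where
  bijective : Function.Bijective fun b => (lev b, l b, r b)
  map_lev : ∀ a b, lev (a * b) = min (lev a) (lev b)
  map_left : ∀ a b, l (a * b) = if s ∨ lev a ≤ lev b then l a else l b
  map_right : ∀ a b, r (a * b) = if t ∨ lev b ≤ lev a then r b else r a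

/-- Left and right coordinates combine, the right ones being left coordinates on the opposite
band. -/
theorem IsLevelMap.isCoordinates {B I J : Type*} [Band B] {lev : B → ℚ} (hl : IsLevelMap lev)
    {s t : Bool} {l : B → I} {r : Bᵐᵒᵖ → J} (hleft : IsLeftCoord lev s l)
    (hright : IsLeftCoord (lev ∘ MulOpposite.unop) t r) : IsCoordinates s t lev l (r ∘ MulOpposite.op) := by
  have left_of_le : ∀ a b, lev a ≤ lev b → l (a * b) = l a := fun a b h =>
    ((hleft.eq_iff _ _ (hl.map_mul_of_le h)).2 (by rw [← mul_assoc, mul_self]))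
  have right_of_le : ∀ a b, lev b ≤ lev a → r (MulOpposite.op (a * b)) = r (MulOpposite.op b) := fun a b h =>
    ((hright.eq_iff _ _ (hl.map_mul_of_ge h)).2
      (congrArg MulOpposite.op (show a * b * b = a * b by rw [mul_assoc, mul_self])))
  refine ⟨⟨?_, ?_⟩, hl.map_mul, ?_, ?_⟩
  · intro a b hab
    simp only [Prod.mk.injEq] at hab
    obtain ⟨h1, h2, h3⟩ := hab
    have h4 := (hleft.eq_iff _ _ h1.symm).1 h2.symm
    have h5 : a * b = a := congrArg MulOpposite.unop ((hright.eq_iff (MulOpposite.op a) (MulOpposite.op b) h1).1 h3)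
    rw [← h5, h4]
  · rintro ⟨q, i, j⟩
    obtain ⟨b, rfl, rfl⟩ := hleft.surj q i
    obtain ⟨c, hc, rfl⟩ := hright.surj (lev b) j
    have hc' : lev c.unop = lev b := hc
    refine ⟨b * c.unop, ?_⟩
    simp only [Prod.mk.injEq, Function.comp_apply]
    exact ⟨hl.map_mul_of_le hc'.ge, left_of_le _ _ hc'.ge, right_of_le _ _ hc'.le⟩
  · intro a b
    rcases le_or_gt (lev a) (lev b) with h | h
    · simp [h, left_of_le]
    · simp [h.not_ge, hleft.map_mul a b h]
  · intro a b
    rcases le_or_gt (lev b) (lev a) with h | h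
    · rw [if_pos (.inr h)]
      exact right_of_le a b h
    · have h1 := hright.map_mul (MulOpposite.op b) (MulOpposite.op a) h
      rw [← MulOpposite.op_mul] at h1
      simpa only [Function.comp_apply, h.not_ge, or_false] using h1

namespace IsCoordinates

section Mul

variable {B I J : Type*} [Mul B] {s t : Bool} {lev : B → ℚ} {l : B → I} {r : B → J}
  (C : IsCoordinates s t lev l r)
include C

theorem ext {a b : B} (h1 : lev a = lev b) (h2 : l a = l b) (h3 : r a = r b) : a = b :=
  C.bijective.1 (by simp only [h1, h2, h3])

theorem exists_mulEquiv {B' : Type*} [Mul B'] {lev' : B' → ℚ} {l' : B' → I} {r' : B' → J}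
    (C' : IsCoordinates s t lev' l' r') :
    ∃ φ : B ≃* B', ∀ b, lev' (φ b) = lev b ∧ l' (φ b) = l b ∧ r' (φ b) = r b := by
  let e := (Equiv.ofBijective _ C.bijective).trans (Equiv.ofBijective _ C'.bijective).symm
  have he : ∀ b, lev' (e b) = lev b ∧ l' (e b) = l b ∧ r' (e b) = r b := by
    intro b
    have := Equiv.ofBijective_apply_symm_apply _ C'.bijective (lev b, l b, r b)
    simp only [Prod.mk.injEq] at this
    exact this
  refine ⟨{ e with map_mul' := fun a b => C'.ext ?_ ?_ ?_ }, he⟩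
  · simp [he, C.map_lev, C'.map_lev]
  · simp [he, C.map_left, C'.map_left]
  · simp [he, C.map_right, C'.map_right]

theorem comp_mulEquiv {B' : Type*} [Mul B'] (e : B' ≃* B) :
    IsCoordinates s t (lev ∘ e) (l ∘ e) (r ∘ e) where
  bijective := C.bijective.comp e.bijective
  map_lev a b := by simp [C.map_lev]
  map_left a b := by simp [C.map_left]
  map_right a b := by simp [C.map_right]

end Mul

variable {B I J : Type*} [Band B] {s t : Bool} {lev : B → ℚ} {l : B → I} {r : B → J}
  (C : IsCoordinates s t lev l r)
include C

theorem isLevelMap [Nonempty I] [Nonempty J] : IsLevelMap lev where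
  surj q := by
    obtain ⟨b, hb⟩ := C.bijective.2 (q, Classical.arbitrary I, Classical.arbitrary J)
    exact ⟨b, congrArg Prod.fst hb⟩
  le_iff a b := by
    constructor
    · intro h
      have h1 : lev (a * b) = lev a := by rw [C.map_lev, min_eq_left h]
      refine C.ext ?_ ?_ ?_
      · rw [C.map_lev, h1, min_self]
      · rw [C.map_left, if_pos (.inr h1.le), C.map_left, if_pos (.inr h)]
      · rw [C.map_right, if_pos (.inr h1.ge)]
    · intro h
      rw [← h, C.map_lev, C.map_lev]
      exact (min_le_left _ _).trans (min_le_right _ _)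

theorem left_eq_iff {a b : B} (h : lev a ≤ lev b) (hs : s ∨ lev a = lev b) :
    l a = l b ↔ b * a = a := by
  have h1 : l (b * a) = l b := by
    rw [C.map_left, if_pos (hs.imp_right Eq.ge)]
  refine ⟨fun H => C.ext ?_ ?_ ?_, fun H => by rw [← h1, H]⟩
  · rw [C.map_lev, min_eq_right h]
  · rw [h1, H]
  · rw [C.map_right, if_pos (.inr h)]

theorem right_eq_iff {a b : B} (h : lev a ≤ lev b) (ht : t ∨ lev a = lev b) :
    r a = r b ↔ a * b = a := by
  have h1 : r (a * b) = r b := by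
    rw [C.map_right, if_pos (ht.imp_right Eq.ge)]
  refine ⟨fun H => C.ext ?_ ?_ ?_, fun H => by rw [← h1, H]⟩
  · rw [C.map_lev, min_eq_left h]
  · rw [C.map_left, if_pos (.inr h)]
  · rw [h1, H]

/-- Finitely generated subbands are finite, as a product takes each coordinate from a factor. -/
theorem finite_closure {S : Set B} (hS : S.Finite) :
    (Subsemigroup.closure S : Set B).Finite := by
  let T : Subsemigroup B :=
    { carrier := (fun b => (lev b, l b, r b)) ⁻¹' ((lev '' S) ×ˢ (l '' S) ×ˢ (r '' S))
      mul_mem' := by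
        rintro a b ⟨h1, h2, h3⟩ ⟨h1', h2', h3'⟩
        refine ⟨?_, ?_, ?_⟩
        · simp only [C.map_lev]
          rcases min_choice (lev a) (lev b) with h | h <;> rw [h] <;> assumption
        · simp only [C.map_left]
          split_ifs <;> assumption
        · simp only [C.map_right]
          split_ifs <;> assumption }
  have hT : (T : Set B).Finite :=
    Set.Finite.preimage (f := fun b => (lev b, l b, r b)) C.bijective.1.injOn
      ((hS.image _).prod ((hS.image _).prod (hS.image _)))
  exact hT.subset (Subsemigroup.closure_le.2 fun b hb =>
    ⟨Set.mem_image_of_mem _ hb, Set.mem_image_of_mem _ hb, Set.mem_image_of_mem _ hb⟩)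

/-- Permuting the coordinates, level by level, gives another system of coordinates; a coordinate
passed on between levels has to be permuted in the same way on all of them. -/
theorem twist {f : ℚ ≃o ℚ} {σ : ℚ → Equiv.Perm I} {τ : ℚ → Equiv.Perm J}
    (hσ : s → ∀ p q, σ p = σ q) (hτ : t → ∀ p q, τ p = τ q) :
    IsCoordinates s t (fun b => f (lev b)) (fun b => σ (lev b) (l b))
      (fun b => τ (lev b) (r b)) where
  bijective := by
    constructor
    · intro a b h
      simp only [Prod.mk.injEq, f.injective.eq_iff] at h
      obtain ⟨h1, h2, h3⟩ := h
      rw [h1] at h2 h3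
      exact C.ext h1 ((σ _).injective h2) ((τ _).injective h3)
    · rintro ⟨q, i, j⟩
      obtain ⟨b, hb⟩ := C.bijective.2 (f.symm q, (σ (f.symm q)).symm i, (τ (f.symm q)).symm j)
      simp only [Prod.mk.injEq] at hb
      exact ⟨b, by simp [hb.1, hb.2.1, hb.2.2]⟩
  map_lev a b := by simp only [C.map_lev]; exact f.monotone.map_min
  map_left a b := by
    simp only [C.map_left, C.map_lev, f.le_iff_le]
    rcases le_or_gt (lev a) (lev b) with h | h
    · simp [h]
    · cases s
      · simp [h.not_ge, h.le]
      · simp [hσ rfl (min (lev a) (lev b)) (lev a)]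
  map_right a b := by
    simp only [C.map_right, C.map_lev, f.le_iff_le]
    rcases le_or_gt (lev b) (lev a) with h | h
    · simp [h]
    · cases t
      · simp [h.not_ge, h.le]
      · simp [hτ rfl (min (lev a) (lev b)) (lev b)]

end IsCoordinates

/-! ### Extension of finite partial maps -/

theorem exists_perm_extending {ι I : Type*} [Finite ι] (u v : ι → I)
    (h : ∀ a b, u a = u b ↔ v a = v b) : ∃ σ : Equiv.Perm I, ∀ a, σ (u a) = v a := by
  -- a partial injection with finite domain leaves complements of equal size
  choose g hg using fun x : Set.range u => x.2
  have hgu : ∀ a, v (g ⟨u a, a, rfl⟩) = v a := fun a => (h _ _).1 (hg _)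
  let F : Set.range u ↪ I := ⟨fun x => v (g x), fun x y hxy =>
    Subtype.ext (by rw [← hg x, ← hg y]; exact (h _ _).2 hxy)⟩
  have hF : ∃ σ : I ≃ I, ∀ x : Set.range u, σ x = F x := by
    cases finite_or_infinite I
    · exact Cardinal.extend_function_finite F ⟨Equiv.refl I⟩
    · exact Cardinal.extend_function_of_lt F
        ((Cardinal.lt_aleph0_of_finite _).trans_le (Cardinal.aleph0_le_mk I)) ⟨Equiv.refl I⟩
  obtain ⟨σ, hσ⟩ := hF
  exact ⟨σ, fun a => (hσ ⟨u a, a, rfl⟩).trans (hgu a)⟩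

/-- Levelwise extension of a partial injection, by the same permutation on all levels if `s`
holds. -/
theorem exists_perms_extending {ι I : Type*} [Finite ι] (s : Bool) (p : ι → ℚ) (u v : ι → I)
    (h : ∀ a b, p a ≤ p b → s ∨ p a = p b → (u a = u b ↔ v a = v b)) :
    ∃ σ : ℚ → Equiv.Perm I, (s → ∀ p q, σ p = σ q) ∧ ∀ a, σ (p a) (u a) = v a := by
  cases s
  · choose σ hσ using fun q => exists_perm_extending (ι := {a // p a = q}) (fun a => u a)
      (fun a => v a) (fun a b => h a b (by rw [a.2, b.2]) (.inr (by rw [a.2, b.2])))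
    exact ⟨σ, by simp, fun a => hσ _ ⟨a, rfl⟩⟩
  · obtain ⟨σ, hσ⟩ := exists_perm_extending u v fun a b => by
      rcases le_total (p a) (p b) with hab | hab
      · exact h a b hab (.inl rfl)
      · rw [eq_comm, h b a hab (.inl rfl), eq_comm]
    exact ⟨fun _ => σ, fun _ _ _ => rfl, hσ⟩

open Order in
/-- The chain `ℚ` is homogeneous, by the back-and-forth argument of Cantor's theorem. -/
theorem exists_orderIso_extending {ι : Type*} [Finite ι] (u v : ι → ℚ)
    (h : ∀ a b, u a ≤ u b ↔ v a ≤ v b) : ∃ f : ℚ ≃o ℚ, ∀ a, f (u a) = v a := by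
  classical
  have := Fintype.ofFinite ι
  let p₀ : PartialIso ℚ ℚ := ⟨Finset.univ.image fun a => (u a, v a), by
    simp only [Finset.mem_image, Finset.mem_univ, true_and, forall_exists_index,
      forall_apply_eq_imp_iff]
    intro a b
    rcases lt_trichotomy (u a) (u b) with hab | hab | hab
    · rw [cmp_eq_lt_iff _ _ |>.2 hab, eq_comm, cmp_eq_lt_iff, ← not_le, ← h]
      exact hab.not_ge
    · rw [cmp_eq_eq_iff _ _ |>.2 hab, eq_comm, cmp_eq_eq_iff]
      exact le_antisymm ((h a b).1 hab.le) ((h b a).1 hab.ge)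
    · rw [cmp_eq_gt_iff _ _ |>.2 hab, eq_comm, cmp_eq_gt_iff, ← not_le, ← h]
      exact hab.not_ge⟩
  let D : ℚ ⊕ ℚ → Cofinal (PartialIso ℚ ℚ) := fun p =>
    Sum.recOn p (PartialIso.definedAtLeft ℚ) (PartialIso.definedAtRight ℚ)
  let K : Ideal (PartialIso ℚ ℚ) := idealOfCofinals p₀ D
  let F a := PartialIso.funOfIdeal a K (cofinal_meets_idealOfCofinals _ D (Sum.inl a))
  let G b := PartialIso.invOfIdeal b K (cofinal_meets_idealOfCofinals _ D (Sum.inr b))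
  refine ⟨OrderIso.ofCmpEqCmp (fun a => (F a).val) (fun b => (G b).val) fun a b => ?_, ?_⟩
  · rcases (F a).prop with ⟨f, hf, ha⟩
    rcases (G b).prop with ⟨g, hg, hb⟩
    rcases K.directed _ hf _ hg with ⟨m, _, fm, gm⟩
    exact m.prop (a, _) (fm ha) (_, b) (gm hb)
  · intro i
    rcases (F (u i)).prop with ⟨f, hf, ha⟩
    rcases K.directed _ hf _ (mem_idealOfCofinals p₀ D) with ⟨m, _, fm, gm⟩
    have h1 := m.prop _ (fm ha) _ (gm (Finset.mem_image_of_mem (fun a => (u a, v a))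
      (Finset.mem_univ i)))
    exact (cmp_eq_eq_iff _ _).1 (h1.symm.trans ((cmp_eq_eq_iff _ _).2 rfl))

/-! ### Homogeneity of the coordinatized bands -/

theorem cls_mul {B : Type*} [Band B] (a b : B) : cls (a * b) = cls a * cls b := rfl

theorem exists_cls_eq {B : Type*} [Band B] (y : StructureSemilattice B) : ∃ b, cls b = y :=
  Quotient.inductionOn y fun b => ⟨b, rfl⟩

namespace IsLevelMap

variable {B : Type*} [Band B] {lev : B → ℚ} (hl : IsLevelMap lev)
include hl

theorem cls_eq_iff {a b : B} : cls a = cls b ↔ lev a = lev b := by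
  rw [le_antisymm_iff (a := lev a), hl.le_iff, hl.le_iff]
  exact Con.eq _

theorem cls_mul_eq_iff {a b : B} : cls a * cls b = cls a ↔ lev a ≤ lev b := by
  rw [← cls_mul, hl.cls_eq_iff, hl.map_mul, min_eq_left_iff]

/-- An automorphism of the structure semilattice, read as an automorphism of the chain `ℚ`. -/
theorem exists_orderIso (π : StructureSemilattice B ≃* StructureSemilattice B) :
    ∃ f : ℚ ≃o ℚ, ∀ a b, π (cls a) = cls b ↔ f (lev a) = lev b := by
  choose rep hrep using exists_cls_eq (B := B)
  choose sec hsec using hl.surj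
  have hcls : ∀ a, cls (sec (lev a)) = cls a := fun a => by rw [hl.cls_eq_iff, hsec]
  let f : ℚ ≃o ℚ :=
    { toFun := fun q => lev (rep (π (cls (sec q))))
      invFun := fun q => lev (rep (π.symm (cls (sec q))))
      left_inv := fun q => by
        simp only [hcls, hrep, MulEquiv.symm_apply_apply]
        rw [← hsec q, ← hl.cls_eq_iff, hrep, hsec]
      right_inv := fun q => by
        simp only [hcls, hrep, MulEquiv.apply_symm_apply]
        rw [← hsec q, ← hl.cls_eq_iff, hrep, hsec]
      map_rel_iff' := by
        intro p q
        simp only [Equiv.coe_fn_mk]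
        rw [← hl.cls_mul_eq_iff, hrep, hrep, ← _root_.map_mul, π.injective.eq_iff, hl.cls_mul_eq_iff,
          hsec, hsec] }
  refine ⟨f, fun a b => ?_⟩
  change _ ↔ lev (rep (π (cls (sec (lev a))))) = lev b
  rw [← hl.cls_eq_iff, hrep, hcls]

end IsLevelMap

/-- An isomorphism between finite subbands extends to an automorphism of `B` inducing any given
automorphism `f` of `ℚ` that agrees with it on levels: it preserves equality of coordinates, since
for `lev a ≤ lev b` this equality is expressed by products wherever it matters. -/
theorem IsCoordinates.exists_extension {B I J : Type*} [Band B] {s t : Bool} {lev : B → ℚ}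
    {l : B → I} {r : B → J} (C : IsCoordinates s t lev l r) {A₁ A₂ : Subsemigroup B} [Finite A₁]
    (θ : A₁ ≃* A₂) (f : ℚ ≃o ℚ) (hf : ∀ a : A₁, f (lev a) = lev (θ a : B)) :
    ∃ φ : B ≃* B, (∀ a : A₁, φ (a : B) = θ a) ∧ ∀ b, lev (φ b) = f (lev b) := by
  have hmul : ∀ a b c : A₁, (a : B) * b = c ↔ (θ a : B) * θ b = θ c := by
    intro a b c
    rw [← MulMemClass.coe_mul, ← MulMemClass.coe_mul, ← map_mul, Subtype.coe_inj,
      Subtype.coe_inj, θ.injective.eq_iff]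
  obtain ⟨σ, hσ, hσl⟩ := exists_perms_extending s (fun a : A₁ => lev a) (fun a => l a)
    (fun a => l (θ a)) fun a b hab hs => by
      rw [C.left_eq_iff hab hs, hmul, ← C.left_eq_iff]
      · rwa [← hf, ← hf, f.le_iff_le]
      · rwa [← hf, ← hf, f.injective.eq_iff]
  obtain ⟨τ, hτ, hτr⟩ := exists_perms_extending t (fun a : A₁ => lev a) (fun a => r a)
    (fun a => r (θ a)) fun a b hab ht => by
      rw [C.right_eq_iff hab ht, hmul, ← C.right_eq_iff]
      · rwa [← hf, ← hf, f.le_iff_le]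
      · rwa [← hf, ← hf, f.injective.eq_iff]
  obtain ⟨φ, hφ⟩ := (C.twist (f := f) hσ hτ).exists_mulEquiv C
  exact ⟨φ, fun a => C.ext ((hφ a).1.trans (hf a)) ((hφ a).2.1.trans (hσl a))
    ((hφ a).2.2.trans (hτr a)), fun b => (hφ b).1⟩

theorem IsCoordinates.isStructureHomogeneous {B I J : Type*} [Band B] [Nonempty I] [Nonempty J]
    {s t : Bool} {lev : B → ℚ} {l : B → I} {r : B → J} (C : IsCoordinates s t lev l r) :
    IsStructureHomogeneous B := by
  have hl := C.isLevelMap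
  constructor
  · rintro A₁ A₂ ⟨S, rfl⟩ - θ
    have : Finite (Subsemigroup.closure (S : Set B)) := C.finite_closure S.finite_toSet
    obtain ⟨f, hf⟩ := exists_orderIso_extending
      (fun a : Subsemigroup.closure (S : Set B) => lev a) (fun a => lev (θ a)) fun a b => by
        simp only [hl.le_iff, ← MulMemClass.coe_mul, ← map_mul, Subtype.coe_inj,
          θ.injective.eq_iff]
    obtain ⟨φ, hφ, -⟩ := C.exists_extension θ f hf
    exact ⟨φ, hφ⟩
  · intro A₁ A₂ hA₁ _ θ π hπ
    have : Finite A₁ := hA₁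
    obtain ⟨f, hf⟩ := hl.exists_orderIso π
    obtain ⟨φ, hφ, hlev⟩ := C.exists_extension θ f fun a => (hf _ _).1 (hπ a)
    exact ⟨φ, hφ, fun b => ((hf _ _).2 (hlev b).symm).symm⟩

/-! ### The structure semilattice is the chain of rationals -/

theorem exists_levelMap {B : Type*} [Band B] [Countable B] [Nontrivial (StructureSemilattice B)]
    (hB : IsLinearlyOrdered B) (h : ExtendsFinite B) : ∃ lev : B → ℚ, IsLevelMap lev := by
  classical
  have comm : ∀ α β : StructureSemilattice B, α * β = β * α := fun α β => by
    rcases hB α β with h | h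
    · rw [h.1, h.2]
    · rw [h.1, h.2]
  let _ : LinearOrder (StructureSemilattice B) :=
    { le := fun α β => α * β = α
      le_refl := fun α => by
        obtain ⟨a, rfl⟩ := exists_cls_eq α
        rw [← cls_mul, mul_self]
      le_trans := fun α β γ h1 h2 => by
        rw [← h1, mul_assoc, h2]
      le_antisymm := fun α β h1 h2 => by rw [← h1, comm, h2]
      le_total := fun α β => (hB α β).imp And.left And.left
      toDecidableLE := Classical.decRel _ }
  have le_def : ∀ a b : B, cls a ≤ cls b ↔ a * b * a = a := by
    intro a b
    refine (Con.eq _).trans ⟨fun H => ?_, fun H => ⟨below_left a b, ?_⟩⟩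
    · have := H.2
      rwa [← mul_assoc, mul_self] at this
    · rw [← mul_assoc, mul_self, H]
  have map_lt : ∀ (φ : B ≃* B) a b, cls (φ a) < cls (φ b) ↔ cls a < cls b := by
    intro φ a b
    rw [← not_le, ← not_le, le_def, le_def, ← map_mul, ← map_mul, φ.injective.eq_iff]
  have natLE_lt : ∀ {a b : B}, NatLE a b → a ≠ b → cls a < cls b := by
    intro a b hab hne
    rw [← not_le, le_def, hab.2, hab.1]
    exact hne
  have exists_natLE : ∀ {a b : B}, cls a < cls b → ∃ x, cls x = cls a ∧ NatLE x b ∧ x ≠ b := by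
    intro a b hab
    refine ⟨b * a * b, ?_, ⟨by rw [mul_assoc, mul_self], by rw [← mul_assoc, ← mul_assoc,
      mul_self]⟩, fun hcon => ?_⟩
    · have h1 : cls a * cls b = cls a := hab.le
      rw [cls_mul, cls_mul, comm (cls b), h1, h1]
    · exact hab.not_ge ((le_def b a).2 hcon)
  obtain ⟨x₀, e₀, hx₀, hne₀⟩ : ∃ x e : B, NatLE x e ∧ x ≠ e := by
    obtain ⟨α, β, hαβ⟩ := exists_pair_lt (StructureSemilattice B)
    obtain ⟨a, rfl⟩ := exists_cls_eq α
    obtain ⟨b, rfl⟩ := exists_cls_eq β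
    obtain ⟨x, -, h1, h2⟩ := exists_natLE hαβ
    exact ⟨x, b, h1, h2⟩
  have above : ∀ b : B, ∃ c, NatLE b c ∧ b ≠ c := by
    intro b
    obtain ⟨φ, rfl⟩ := h.exists_map_eq x₀ b
    exact ⟨φ e₀, ⟨by rw [← map_mul, hx₀.1], by rw [← map_mul, hx₀.2]⟩, φ.injective.ne hne₀⟩
  have : NoMaxOrder (StructureSemilattice B) := ⟨fun β => by
    obtain ⟨b, rfl⟩ := exists_cls_eq β
    obtain ⟨c, h1, h2⟩ := above b
    exact ⟨cls c, natLE_lt h1 h2⟩⟩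
  have : NoMinOrder (StructureSemilattice B) := ⟨fun β => by
    obtain ⟨b, rfl⟩ := exists_cls_eq β
    obtain ⟨φ, rfl⟩ := h.exists_map_eq e₀ b
    exact ⟨cls (φ x₀), (map_lt φ _ _).2 (natLE_lt hx₀ hne₀)⟩⟩
  -- the pair `x < c` with `b` in between is conjugate to the pair `x < b`
  have : DenselyOrdered (StructureSemilattice B) := ⟨fun α β hαβ => by
    obtain ⟨a, rfl⟩ := exists_cls_eq α
    obtain ⟨b, rfl⟩ := exists_cls_eq β
    obtain ⟨x, hxa, h1, h2⟩ := exists_natLE hαβ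
    obtain ⟨c, h3, h4⟩ := above b
    have hxb := natLE_lt h1 h2
    have hbc := natLE_lt h3 h4
    have hxc : NatLE x c := ⟨by rw [← h1.1, mul_assoc, h3.1], by rw [← h1.2, ← mul_assoc, h3.2]⟩
    obtain ⟨φ, h5, h6⟩ := h.exists_map_natLE hxc
      (by rintro rfl; exact (hxb.trans hbc).false) h1 h2
    refine ⟨cls (φ b), ?_, ?_⟩
    · rw [← hxa, ← h5, map_lt]; exact hxb
    · have h7 := (map_lt φ b c).2 hbc
      rwa [h6] at h7⟩
  have : Countable (StructureSemilattice B) :=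
    Function.Surjective.countable (f := cls) exists_cls_eq
  obtain ⟨e⟩ := Order.iso_of_countable_dense (StructureSemilattice B) ℚ
  refine ⟨fun b => e (cls b), fun q => ?_, fun a b => by rw [e.le_iff_le, le_def]⟩
  obtain ⟨b, hb⟩ := exists_cls_eq (e.symm q)
  exact ⟨b, by simp [hb]⟩

theorem IsHomogeneous.exists_isCoordinates {B : Type*} [Band B] [Countable B]
    [Nontrivial (StructureSemilattice B)] (hB : IsLinearlyOrdered B) (h : IsHomogeneous B) :
    ∃ n m : ℕ∞, n ≠ 0 ∧ m ≠ 0 ∧ ∃ (s t : Bool) (lev : B → ℚ) (l : B → Idx n) (r : B → Idx m),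
      IsCoordinates s t lev l r := by
  have hE := h.extendsFinite
  obtain ⟨lev, hl⟩ := exists_levelMap hB hE
  have : Countable Bᵐᵒᵖ := MulOpposite.unop_injective.countable
  obtain ⟨n, hn, s, l, hleft⟩ := exists_leftCoord hE hl
  obtain ⟨m, hm, t, r, hright⟩ := exists_leftCoord hE.op hl.op
  exact ⟨n, m, hn, hm, s, t, lev, l, _, hl.isCoordinates hleft hright⟩

/-! ### Coordinates of the four families -/

theorem nonempty_idx {n : ℕ∞} (hn : n ≠ 0) : Nonempty (Idx n) :=
  ⟨⟨0, by simpa using pos_iff_ne_zero.2 hn⟩⟩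

instance : Subsingleton (Idx 1) := ⟨by
  rintro ⟨a, ha⟩ ⟨b, hb⟩
  have ha' : a < 1 := by exact_mod_cast ha
  have hb' : b < 1 := by exact_mod_cast hb
  exact Subtype.ext ((Nat.lt_one_iff.1 ha').trans (Nat.lt_one_iff.1 hb').symm)⟩

theorem DBand.level_mul {n m : ℕ∞} (x y : DBand n m) : (x * y).level = min x.level y.level :=
  congrArg QChain.val (map_mul (dProj n m) x y)

theorem DBand.left_mul {n m : ℕ∞} (x y : DBand n m) :
    (x * y).elt.left = if x.level ≤ y.level then x.elt.left else y.elt.left := by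
  rcases lt_trichotomy x.level y.level with h | h | h
  · simp [DBand.mul_def, h, h.le]
  · simp [DBand.mul_def, h]; rfl
  · simp [DBand.mul_def, h, h.not_ge, h.not_gt]

theorem DBand.right_mul {n m : ℕ∞} (x y : DBand n m) :
    (x * y).elt.right = if y.level ≤ x.level then y.elt.right else x.elt.right := by
  rcases lt_trichotomy x.level y.level with h | h | h
  · simp [DBand.mul_def, h, h.not_ge]
  · simp [DBand.mul_def, h]; rfl
  · simp [DBand.mul_def, h, h.le, h.not_gt]

theorem isCoordinates_qRect (n m : ℕ∞) : IsCoordinates true true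
    (fun b : QRect n m => b.1.val) (fun b => b.2.left) (fun b => b.2.right) where
  bijective := ⟨fun a b h => by
      simp only [Prod.mk.injEq] at h
      exact Prod.ext (QChain.ext h.1) (Rect.ext h.2.1 h.2.2),
    fun ⟨q, i, j⟩ => ⟨(⟨q⟩, ⟨i, j⟩), rfl⟩⟩
  map_lev _ _ := rfl
  map_left _ _ := by simp; rfl
  map_right _ _ := by simp; rfl

theorem isCoordinates_dBand (n m : ℕ∞) : IsCoordinates false false
    (fun b : DBand n m => b.level) (fun b => b.elt.left) (fun b => b.elt.right) where
  bijective := ⟨fun a b h => by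
      simp only [Prod.mk.injEq] at h
      exact DBand.ext h.1 (Rect.ext h.2.1 h.2.2),
    fun ⟨q, i, j⟩ => ⟨⟨q, i, j⟩, rfl⟩⟩
  map_lev := DBand.level_mul
  map_left a b := by simp [DBand.left_mul]
  map_right a b := by simp [DBand.right_mul]

theorem isCoordinates_qSpinedD (n m : ℕ∞) : IsCoordinates true false
    (fun b : QSpinedD n m => b.1.2.level) (fun b => b.1.1.2.left)
    (fun b => b.1.2.elt.right) where
  bijective := by
    constructor
    · rintro ⟨⟨⟨a1, a2⟩, a3⟩, ha⟩ ⟨⟨⟨b1, b2⟩, b3⟩, hb⟩ h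
      change a1 = ⟨a3.level⟩ at ha
      change b1 = ⟨b3.level⟩ at hb
      simp only [Prod.mk.injEq] at h
      obtain ⟨h1, h2, h3⟩ := h
      refine Subtype.ext (Prod.ext (Prod.ext ?_ (Rect.ext h2 (Subsingleton.elim _ _)))
        (DBand.ext h1 (Rect.ext (Subsingleton.elim _ _) h3)))
      exact ha.trans ((congrArg QChain.mk h1).trans hb.symm)
    · rintro ⟨q, i, j⟩
      obtain ⟨o⟩ := nonempty_idx one_ne_zero
      exact ⟨⟨((⟨q⟩, ⟨i, o⟩), ⟨q, o, j⟩), rfl⟩, rfl⟩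
  map_lev a b := DBand.level_mul _ _
  map_left a b := by simp; rfl
  map_right a b := by simp [DBand.right_mul]

theorem isCoordinates_dSpinedQ (n m : ℕ∞) : IsCoordinates false true
    (fun b : DSpinedQ n m => b.1.1.level) (fun b => b.1.1.elt.left)
    (fun b => b.1.2.2.right) where
  bijective := by
    constructor
    · rintro ⟨⟨a3, a1, a2⟩, ha⟩ ⟨⟨b3, b1, b2⟩, hb⟩ h
      change ⟨a3.level⟩ = a1 at ha
      change ⟨b3.level⟩ = b1 at hb
      simp only [Prod.mk.injEq] at h
      obtain ⟨h1, h2, h3⟩ := h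
      refine Subtype.ext (Prod.ext (DBand.ext h1 (Rect.ext h2 (Subsingleton.elim _ _)))
        (Prod.ext ?_ (Rect.ext (Subsingleton.elim _ _) h3)))
      exact ha.symm.trans ((congrArg QChain.mk h1).trans hb)
    · rintro ⟨q, i, j⟩
      obtain ⟨o⟩ := nonempty_idx one_ne_zero
      exact ⟨⟨(⟨q, i, o⟩, (⟨q⟩, ⟨o, j⟩)), rfl⟩, rfl⟩
  map_lev a b := DBand.level_mul _ _
  map_left a b := by simp [DBand.left_mul]
  map_right a b := by simp; rfl

end Band

theorem mainTheorem3 {B : Type*} [Band B] [Countable B]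
    [Nontrivial (Band.StructureSemilattice B)] (hB : Band.IsLinearlyOrdered B) :
    List.TFAE
      [Band.IsHomogeneous B,
       Band.IsStructureHomogeneous B,
       ∃ n m : ℕ∞, n ≠ 0 ∧ m ≠ 0 ∧
         (Nonempty (B ≃* Band.QRect n m) ∨
          Nonempty (B ≃* Band.DBand n m) ∨
          Nonempty (B ≃* Band.QSpinedD n m) ∨
          Nonempty (B ≃* Band.DSpinedQ n m))] := by
  tfae_have 2 → 1 := And.left
  tfae_have 1 → 3 := by
    intro h
    obtain ⟨n, m, hn, hm, s, t, lev, l, r, C⟩ := h.exists_isCoordinates hB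
    refine ⟨n, m, hn, hm, ?_⟩
    cases s <;> cases t
    · obtain ⟨φ, -⟩ := C.exists_mulEquiv (Band.isCoordinates_dBand n m)
      exact .inr (.inl ⟨φ⟩)
    · obtain ⟨φ, -⟩ := C.exists_mulEquiv (Band.isCoordinates_dSpinedQ n m)
      exact .inr (.inr (.inr ⟨φ⟩))
    · obtain ⟨φ, -⟩ := C.exists_mulEquiv (Band.isCoordinates_qSpinedD n m)
      exact .inr (.inr (.inl ⟨φ⟩))
    · obtain ⟨φ, -⟩ := C.exists_mulEquiv (Band.isCoordinates_qRect n m)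
      exact .inl ⟨φ⟩
  tfae_have 3 → 2 := by
    rintro ⟨n, m, hn, hm, h⟩
    have := Band.nonempty_idx hn
    have := Band.nonempty_idx hm
    rcases h with ⟨⟨e⟩⟩ | ⟨⟨e⟩⟩ | ⟨⟨e⟩⟩ | ⟨⟨e⟩⟩
    · exact ((Band.isCoordinates_qRect n m).comp_mulEquiv e).isStructureHomogeneous
    · exact ((Band.isCoordinates_dBand n m).comp_mulEquiv e).isStructureHomogeneous
    · exact ((Band.isCoordinates_qSpinedD n m).comp_mulEquiv e).isStructureHomogeneous
    · exact ((Band.isCoordinates_dSpinedQ n m).comp_mulEquiv e).isStructureHomogeneous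
  tfae_finish
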